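/- For an integer $m\ge 0$ let $H_m=\sum_{i=1}^{m}\frac1i$ (so $H_0=0$); let $Li_s(x)=\sum_{m\ge1}\frac{x^m}{m^s}$, let $\zeta$ be the Riemann zeta function, let $\log$ be the natural logarithm, and let empty sums be $0$ and $0^0=1$. Theorem. For every integer $n\ge 0$ and every real $t$ with $0<t\le 1$, the following series converges and $$ \begin{aligned} \sum_{k=1}^{\infty}\frac{H_{k-1}\,t^k}{k^2\binom{n+k}{k}} ={}&\zeta(3)-Li_3(1-t)-\frac12\log^2(1-t)\sum_{k=1}^{n}\frac1k\Big(\frac{t-1}{t}\Big)^k\\ &+\big(\zeta(2)-Li_2(t)\big)\log(1-t)+\log(1-t)\sum_{k=1}^{n}\frac{H_k}{k}\Big(\frac{t-1}{t}\Big)^k\\ &-\sum_{p=0}^{n-1}\left\{\sum_{k=1}^{n-p}\left(\frac{H_{p+k}-H_k}{(p+k)k}+\frac{1}{k^2(p+k)}\right)\right\}\Big(\frac{t-1}{t}\Big)^p\\ &-\frac12\log t\,\log^2(1-t). \end{aligned} $$ At $t=1$ the terms containing $\log(1-t)$ are read as $0$; the value of the right-hand side at $t=1$ obtained in this way is also its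 limit as $t\to1^-$. -/

import Mathlib

open Filter Topology

noncomputable section

/-- The polylogarithm `Li_s(x) = ∑_{m ≥ 1} x ^ m / m ^ s` of integer order, as a real function
(the series converges absolutely for `|x| ≤ 1` when `s ≥ 2`). The index is `m = k + 1`. -/
def polylog (s : ℕ) (x : ℝ) : ℝ :=
  ∑' k : ℕ, x ^ (k + 1) / ((k : ℝ) + 1) ^ s

/-- The real harmonic number `H_m = ∑_{i = 1}^{m} 1 / i`, with `H_0 = 0`. -/
def harm (m : ℕ) : ℝ := (harmonic m : ℝ)

/-- The real value of the Riemann zeta function at a natural number `s ≥ 2`, where it is real. -/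
def zetaR (s : ℕ) : ℝ := (riemannZeta (s : ℂ)).re

/-- The `k`-th term, `k ≥ 1`, of the series: `H_{k-1} t ^ k / (k ^ 2 * C(n + k, k))`. -/
def seriesTerm (n : ℕ) (t : ℝ) (k : ℕ) : ℝ :=
  harm (k - 1) * t ^ k / ((k : ℝ) ^ 2 * ((n + k).choose k : ℝ))

/-- The closed form. At `t = 1` the terms that contain `Real.log (1 - t) = Real.log 0 = 0` vanish,
and `((t - 1) / t) ^ 0 = 1`. -/
def closedForm (n : ℕ) (t : ℝ) : ℝ :=
  zetaR 3 - polylog 3 (1 - t)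
    - 1 / 2 * Real.log (1 - t) ^ 2 * ∑ k ∈ Finset.Icc 1 n, 1 / (k : ℝ) * ((t - 1) / t) ^ k
    + (zetaR 2 - polylog 2 t) * Real.log (1 - t)
    + Real.log (1 - t) * ∑ k ∈ Finset.Icc 1 n, harm k / (k : ℝ) * ((t - 1) / t) ^ k
    - ∑ p ∈ Finset.range n,
        (∑ k ∈ Finset.Icc 1 (n - p),
          ((harm (p + k) - harm k) / (((p : ℝ) + k) * k) + 1 / ((k : ℝ) ^ 2 * ((p : ℝ) + k))))
          * ((t - 1) / t) ^ p
    - 1 / 2 * Real.log t * Real.log (1 - t) ^ 2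

end

/-!
The proof is an induction on `n` for `0 < t < 1`, followed by Abel's limit theorem at `t = 1`.

Write `b N j = B(j + 1, N + 1) = 1 / ((j + 1) C(N + j + 1, j + 1))` (`betaNat`), so that the term of
index `k = j + 1` is `H_j b n j t ^ (j + 1) / (j + 1)`. The identities
`b N j - b (N + 1) j = b N (j + 1)` and `(N + 1) b N (j + 1) = (j + 1) b (N + 1) j` show that the
series for `n` and `n + 1` differ by `G (n + 1) / (n + 1)`, where `G N = ∑ H_j b N j t ^ (j + 1)`.
The same identities give, with `u = (t - 1) / t` and `A N = ∑ b N j t ^ (j + 1)`,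
`A (N + 1) = u A N + 1 / (N + 1)` and `G (N + 1) = u G N + A (N + 1) / (N + 1)`
(`hasSum_betaNat_succ`, `hasSum_harm_mul_betaNat_succ`). Starting from `A 0 = -log (1 - t)` and
`G 0 = log² (1 - t) / 2` these are solved by `betaSum` and `harmBetaSum`, and the closed form
satisfies the matching recurrence (`closedForm_succ`).

For `n = 0` both sides vanish at `0` and have the same derivative `log² (1 - t) / (2 t)`
(`hasSum_closedForm_zero`); this uses Euler's reflection formula
`polylog_two_add_polylog_two_one_sub`, itself proved by differentiation. Finally the closed form has
its value at `1` as left limit (`tendsto_closedForm_one`), and since the terms are nonnegative the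
series at `t = 1` converges to that limit (`hasSum_of_tendsto_one`).
-/

/-! ### Harmonic numbers -/

theorem harm_zero : harm 0 = 0 := by simp [harm]

theorem harm_succ (j : ℕ) : harm (j + 1) = harm j + 1 / ((j : ℝ) + 1) := by
  simp [harm, harmonic_succ]

theorem harm_nonneg (j : ℕ) : 0 ≤ harm j := by
  induction j with
  | zero => simp [harm_zero]
  | succ j ih => rw [harm_succ]; positivity

theorem harm_le (j : ℕ) : harm j ≤ j := by
  induction j with
  | zero => simp [harm_zero]
  | succ j ih =>
    rw [harm_succ]
    have : 1 / ((j : ℝ) + 1) ≤ 1 := by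
      rw [div_le_one (by positivity)]
      linarith [(Nat.cast_nonneg j : (0 : ℝ) ≤ j)]
    push_cast
    linarith

/-! ### Beta values and their recurrences -/

/-- The Beta value `B(j + 1, N + 1) = j! N! / (N + j + 1)!`. -/
noncomputable def betaNat (N j : ℕ) : ℝ := (j.factorial : ℝ) * N.factorial / (N + j + 1).factorial

/-- The link with the binomial coefficient `C(N + k, k)` of the series, where `k = j + 1`. -/
theorem betaNat_eq_inv_choose (N j : ℕ) :
    betaNat N j = 1 / (((j : ℝ) + 1) * ((N + (j + 1)).choose (j + 1) : ℝ)) := by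
  have h : ((N + (j + 1)).choose (j + 1) : ℝ) * ((j + 1).factorial : ℝ) * N.factorial
      = (N + j + 1).factorial := by
    have := Nat.add_choose_mul_factorial_mul_factorial N (j + 1)
    rw [mul_right_comm] at this
    exact_mod_cast this
  have hc : ((N + (j + 1)).choose (j + 1) : ℝ) ≠ 0 := by
    exact_mod_cast (Nat.choose_pos (by omega)).ne'
  have h1 : ((N + j + 1).factorial : ℝ) ≠ 0 := by positivity
  have h2 : (j : ℝ) + 1 ≠ 0 := by positivity
  rw [betaNat, div_eq_div_iff h1 (mul_ne_zero h2 hc), ← h, Nat.factorial_succ]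
  push_cast
  ring

theorem betaNat_sub_betaNat_succ (N j : ℕ) :
    betaNat N j - betaNat (N + 1) j = betaNat N (j + 1) := by
  have e1 : N + 1 + j + 1 = (N + j + 1) + 1 := by ring
  have e2 : N + (j + 1) + 1 = (N + j + 1) + 1 := by ring
  simp only [betaNat, e1, e2, Nat.factorial_succ (N + j + 1), Nat.factorial_succ N,
    Nat.factorial_succ j]
  push_cast
  field_simp
  ring

theorem succ_mul_betaNat (N j : ℕ) :
    ((N : ℝ) + 1) * betaNat N (j + 1) = ((j : ℝ) + 1) * betaNat (N + 1) j := by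
  have e1 : N + 1 + j + 1 = (N + j + 1) + 1 := by ring
  have e2 : N + (j + 1) + 1 = (N + j + 1) + 1 := by ring
  simp only [betaNat, e1, e2, Nat.factorial_succ N, Nat.factorial_succ j]
  push_cast
  ring

theorem betaNat_nonneg (N j : ℕ) : 0 ≤ betaNat N j := by
  rw [betaNat]
  positivity

theorem betaNat_zero_right (N : ℕ) : betaNat N 0 = 1 / ((N : ℝ) + 1) := by
  simp only [betaNat, add_zero, Nat.factorial_succ, Nat.factorial_zero]
  push_cast
  field_simp

theorem betaNat_zero_left (j : ℕ) : betaNat 0 j = 1 / ((j : ℝ) + 1) := by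
  simp only [betaNat, zero_add, Nat.factorial_succ, Nat.factorial_zero]
  push_cast
  field_simp

theorem seriesTerm_succ (n : ℕ) (t : ℝ) (j : ℕ) :
    seriesTerm n t (j + 1) = harm j * betaNat n j / ((j : ℝ) + 1) * t ^ (j + 1) := by
  rw [seriesTerm, betaNat_eq_inv_choose, Nat.add_sub_cancel]
  push_cast
  have hc : ((n + (j + 1)).choose (j + 1) : ℝ) ≠ 0 := by
    exact_mod_cast (Nat.choose_pos (by omega)).ne'
  field_simp

/-! ### Series with Beta values -/

/-- One step in `N` for `∑ B(j + 1, N + 1) t ^ (j + 1)`. -/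
theorem hasSum_betaNat_succ {N : ℕ} {t A : ℝ} (ht : t ≠ 0)
    (hA : HasSum (fun j => betaNat N j * t ^ (j + 1)) A) :
    HasSum (fun j => betaNat (N + 1) j * t ^ (j + 1))
      ((t - 1) / t * A + 1 / ((N : ℝ) + 1)) := by
  have h1 := ((hasSum_nat_add_iff' 1).mpr hA).div_const t
  convert! hA.sub h1 using 1
  · funext j
    rw [← sub_eq_of_eq_add' (sub_eq_iff_eq_add'.mp (betaNat_sub_betaNat_succ N j))]
    field_simp
    ring
  · simp [betaNat_zero_right]
    field_simp
    ring

/-- One step in `N` for `∑ H_j B(j + 1, N + 1) t ^ (j + 1)`: summation by parts leaves the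
series without harmonic numbers. -/
theorem hasSum_harm_mul_betaNat_succ {N : ℕ} {t A G : ℝ} (ht : t ≠ 0)
    (hA : HasSum (fun j => betaNat (N + 1) j * t ^ (j + 1)) A)
    (hG : HasSum (fun j => harm j * betaNat N j * t ^ (j + 1)) G) :
    HasSum (fun j => harm j * betaNat (N + 1) j * t ^ (j + 1))
      ((t - 1) / t * G + A / ((N : ℝ) + 1)) := by
  have h1 := ((hasSum_nat_add_iff' 1).mpr hG).div_const t
  convert! (hG.sub h1).add (hA.div_const ((N : ℝ) + 1)) using 1
  · funext j
    have e1 : betaNat (N + 1) j = betaNat N j - betaNat N (j + 1) := by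
      rw [← betaNat_sub_betaNat_succ]; ring
    have e2 : betaNat (N + 1) j / ((N : ℝ) + 1) = betaNat N (j + 1) / ((j : ℝ) + 1) := by
      rw [div_eq_div_iff (by positivity) (by positivity)]
      linarith [succ_mul_betaNat N j]
    rw [mul_div_right_comm (betaNat (N + 1) j), e2, e1, harm_succ]
    field_simp
    ring
  · simp [harm_zero]
    field_simp

/-- The value of `∑ B(j + 1, N + 1) t ^ (j + 1)` for `0 < t < 1`. -/
noncomputable def betaSum (N : ℕ) (t : ℝ) : ℝ :=
  -Real.log (1 - t) * ((t - 1) / t) ^ N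
    + ∑ p ∈ Finset.range N, 1 / ((N - p : ℕ) : ℝ) * ((t - 1) / t) ^ p

theorem hasSum_betaSum {t : ℝ} (h0 : 0 < t) (h1 : t < 1) (N : ℕ) :
    HasSum (fun j => betaNat N j * t ^ (j + 1)) (betaSum N t) := by
  induction N with
  | zero =>
    simpa [betaSum, betaNat_zero_left, div_eq_inv_mul] using
      Real.hasSum_pow_div_log_of_abs_lt_one (x := t) (by rwa [abs_of_pos h0])
  | succ N ih =>
    convert! hasSum_betaNat_succ h0.ne' ih using 1
    simp only [betaSum, Finset.sum_range_succ', Nat.reduceSubDiff, pow_succ, mul_add,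
      Finset.mul_sum]
    push_cast
    simp only [pow_zero, mul_comm, mul_left_comm]
    ring

/-- The value of `∑ H_j B(j + 1, N + 1) t ^ (j + 1)` for `0 < t < 1`. The differences `N - p` are
taken in `ℕ`, with `p < N`. -/
noncomputable def harmBetaSum (N : ℕ) (t : ℝ) : ℝ :=
  1 / 2 * Real.log (1 - t) ^ 2 * ((t - 1) / t) ^ N
    - Real.log (1 - t) * harm N * ((t - 1) / t) ^ N
    + ∑ p ∈ Finset.range N, ((harm N - harm (N - p)) / ((N - p : ℕ) : ℝ)
        + 1 / ((N - p : ℕ) : ℝ) ^ 2) * ((t - 1) / t) ^ p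

theorem harmBetaSum_succ (N : ℕ) (t : ℝ) :
    harmBetaSum (N + 1) t
      = (t - 1) / t * harmBetaSum N t + betaSum (N + 1) t / ((N : ℝ) + 1) := by
  have hs : ∑ p ∈ Finset.range N, ((harm (N + 1) - harm (N - p)) / ((N - p : ℕ) : ℝ)
        + 1 / ((N - p : ℕ) : ℝ) ^ 2) * ((t - 1) / t) ^ (p + 1)
      = (t - 1) / t * ∑ p ∈ Finset.range N, ((harm N - harm (N - p)) / ((N - p : ℕ) : ℝ)
        + 1 / ((N - p : ℕ) : ℝ) ^ 2) * ((t - 1) / t) ^ p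
        + (∑ p ∈ Finset.range N, 1 / ((N - p : ℕ) : ℝ) * ((t - 1) / t) ^ (p + 1))
          / ((N : ℝ) + 1) := by
    rw [Finset.mul_sum, Finset.sum_div, ← Finset.sum_add_distrib]
    refine Finset.sum_congr rfl fun p _ => ?_
    rw [harm_succ]
    ring
  simp only [betaSum, harmBetaSum, Finset.sum_range_succ', Nat.reduceSubDiff, hs, Nat.sub_zero,
    pow_zero, sub_self, zero_div, zero_add, mul_one]
  rw [harm_succ]
  push_cast
  rw [sq ((N : ℝ) + 1), ← one_div_mul_one_div]
  ring

theorem hasSum_harmBetaSum {t : ℝ} (h0 : 0 < t) (h1 : t < 1)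
    (hG : HasSum (fun j : ℕ => harm j / ((j : ℝ) + 1) * t ^ (j + 1))
      (1 / 2 * Real.log (1 - t) ^ 2)) (N : ℕ) :
    HasSum (fun j => harm j * betaNat N j * t ^ (j + 1)) (harmBetaSum N t) := by
  induction N with
  | zero => simpa [harmBetaSum, betaNat_zero_left, div_eq_mul_inv, harm_zero] using hG
  | succ N ih =>
    rw [harmBetaSum_succ]
    exact hasSum_harm_mul_betaNat_succ h0.ne' (hasSum_betaSum h0 h1 (N + 1)) ih

/-! ### Recurrence of the closed form -/

theorem closedForm_succ (n : ℕ) (t : ℝ) :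
    closedForm (n + 1) t = closedForm n t - harmBetaSum (n + 1) t / ((n : ℝ) + 1) := by
  have hs : ∑ p ∈ Finset.range (n + 1), (∑ k ∈ Finset.Icc 1 (n + 1 - p),
        ((harm (p + k) - harm k) / (((p : ℝ) + k) * k) + 1 / ((k : ℝ) ^ 2 * ((p : ℝ) + k))))
          * ((t - 1) / t) ^ p
      = ∑ p ∈ Finset.range n, (∑ k ∈ Finset.Icc 1 (n - p),
        ((harm (p + k) - harm k) / (((p : ℝ) + k) * k) + 1 / ((k : ℝ) ^ 2 * ((p : ℝ) + k))))
          * ((t - 1) / t) ^ p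
        + (∑ p ∈ Finset.range (n + 1), ((harm (n + 1) - harm (n + 1 - p))
            / ((n + 1 - p : ℕ) : ℝ) + 1 / ((n + 1 - p : ℕ) : ℝ) ^ 2) * ((t - 1) / t) ^ p)
          / ((n : ℝ) + 1) := by
    -- The summand `p = n` is an empty sum, so both sides can range over `p ≤ n`.
    have hn : ∑ p ∈ Finset.range n, (∑ k ∈ Finset.Icc 1 (n - p),
        ((harm (p + k) - harm k) / (((p : ℝ) + k) * k) + 1 / ((k : ℝ) ^ 2 * ((p : ℝ) + k))))
          * ((t - 1) / t) ^ p
        = ∑ p ∈ Finset.range (n + 1), (∑ k ∈ Finset.Icc 1 (n - p),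
        ((harm (p + k) - harm k) / (((p : ℝ) + k) * k) + 1 / ((k : ℝ) ^ 2 * ((p : ℝ) + k))))
          * ((t - 1) / t) ^ p := by
      simp [Finset.sum_range_succ]
    rw [hn, Finset.sum_div, ← Finset.sum_add_distrib]
    refine Finset.sum_congr rfl fun p hp => ?_
    have hp' : p ≤ n := by simpa [Nat.lt_succ_iff] using hp
    obtain ⟨m, rfl⟩ := Nat.exists_eq_add_of_le hp'
    have e1 : p + m + 1 - p = m + 1 := by omega
    have e2 : p + m - p = m := by omega
    rw [e1, e2, Finset.sum_Icc_succ_top (by omega), ← add_assoc]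
    have e3 : ((p : ℝ) + ((m + 1 : ℕ) : ℝ)) = (((p + m : ℕ) : ℝ) + 1) := by push_cast; ring
    rw [e3]
    have h3 : (((p + m : ℕ) : ℝ) + 1) ≠ 0 := by positivity
    have h4 : ((m + 1 : ℕ) : ℝ) ≠ 0 := by positivity
    rw [add_assoc, add_mul, add_right_inj, mul_div_right_comm]
    congr 1
    rw [← add_assoc]
    field_simp
  simp only [closedForm, harmBetaSum, hs, Finset.sum_Icc_succ_top (Nat.succ_le_succ n.zero_le)]
  push_cast
  ring

/-- The terms of the series for `n` and `n + 1` differ by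
`H_j B(j + 1, n + 2) t ^ (j + 1) / (n + 1)`, as the closed forms do by `closedForm_succ`. -/
theorem hasSum_closedForm_of_zero {t : ℝ} (h0 : 0 < t) (h1 : t < 1)
    (hG : HasSum (fun j : ℕ => harm j / ((j : ℝ) + 1) * t ^ (j + 1))
      (1 / 2 * Real.log (1 - t) ^ 2))
    (hF : HasSum (fun j : ℕ => seriesTerm 0 t (j + 1)) (closedForm 0 t)) (n : ℕ) :
    HasSum (fun j : ℕ => seriesTerm n t (j + 1)) (closedForm n t) := by
  induction n with
  | zero => exact hF
  | succ n ih =>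
    rw [closedForm_succ]
    convert! ih.sub ((hasSum_harmBetaSum h0 h1 hG (n + 1)).div_const ((n : ℝ) + 1)) using 1
    funext j
    have e1 : betaNat (n + 1) j = betaNat n j - betaNat n (j + 1) := by
      rw [← betaNat_sub_betaNat_succ]; ring
    have e2 : betaNat (n + 1) j / ((n : ℝ) + 1) = betaNat n (j + 1) / ((j : ℝ) + 1) := by
      rw [div_eq_div_iff (by positivity) (by positivity)]
      linarith [succ_mul_betaNat n j]
    have e3 : harm j * betaNat (n + 1) j * t ^ (j + 1) / ((n : ℝ) + 1)
        = harm j * t ^ (j + 1) * (betaNat (n + 1) j / ((n : ℝ) + 1)) := by ring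
    rw [e3, e2, seriesTerm_succ, seriesTerm_succ, e1]
    ring

/-! ### Power series with coefficients of at most linear growth -/

theorem summable_succ_mul_pow {r : ℝ} (h0 : 0 ≤ r) (h1 : r < 1) :
    Summable fun j : ℕ => ((j : ℝ) + 1) * r ^ j := by
  have hr : ‖r‖ < 1 := by rwa [Real.norm_of_nonneg h0]
  have h := (summable_pow_mul_geometric_of_norm_lt_one 1 hr).add
    (summable_geometric_of_norm_lt_one hr)
  refine h.congr fun j => ?_
  ring

theorem norm_mul_pow_le {a : ℕ → ℝ} (ha : ∀ j : ℕ, |a j| ≤ (j : ℝ) + 1) {x r : ℝ} (hx : |x| ≤ r)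
    (j : ℕ) : ‖a j * x ^ j‖ ≤ ((j : ℝ) + 1) * r ^ j := by
  rw [Real.norm_eq_abs, abs_mul, abs_pow]
  have := ha j
  gcongr

theorem summable_mul_pow {a : ℕ → ℝ} (ha : ∀ j : ℕ, |a j| ≤ (j : ℝ) + 1) {x : ℝ} (hx : |x| < 1) :
    Summable fun j => a j * x ^ j :=
  .of_norm_bounded (summable_succ_mul_pow (abs_nonneg x) hx) (norm_mul_pow_le ha le_rfl)

/-- Termwise differentiation of a power series with coefficients of at most linear growth. -/
theorem hasDerivAt_tsum_div_mul_pow {a : ℕ → ℝ} (ha : ∀ j : ℕ, |a j| ≤ (j : ℝ) + 1) {x : ℝ}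
    (hx : |x| < 1) :
    HasDerivAt (fun y => ∑' j : ℕ, a j / ((j : ℝ) + 1) * y ^ (j + 1)) (∑' j : ℕ, a j * x ^ j) x := by
  obtain ⟨r, hxr, hr⟩ := exists_between hx
  have hr0 : 0 < r := (abs_nonneg x).trans_lt hxr
  refine hasDerivAt_tsum_of_isPreconnected (summable_succ_mul_pow hr0.le hr)
    (g' := fun j y => a j * y ^ j) (t := Metric.ball (0 : ℝ) r) Metric.isOpen_ball
    (convex_ball (0 : ℝ) r).isPreconnected
    (fun j y _ => ?_) (fun j y hy => ?_) (Metric.mem_ball_self hr0) ?_ (by simpa using hxr)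
  · have h := (hasDerivAt_pow (j + 1) y).const_mul (a j / ((j : ℝ) + 1))
    convert! h using 1
    rw [Nat.add_sub_cancel]
    push_cast
    field_simp
  · exact norm_mul_pow_le ha (by simpa using (Metric.mem_ball.mp hy).le) j
  · simp

theorem hasSum_div_mul_pow {a : ℕ → ℝ} (ha : ∀ j : ℕ, |a j| ≤ (j : ℝ) + 1) {x : ℝ} (hx : |x| < 1) :
    HasSum (fun j : ℕ => a j / ((j : ℝ) + 1) * x ^ (j + 1))
      (∑' j : ℕ, a j / ((j : ℝ) + 1) * x ^ (j + 1)) := by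
  have h : ∀ j : ℕ, |a j / ((j : ℝ) + 1)| ≤ (j : ℝ) + 1 := fun j => by
    rw [abs_div, abs_of_pos (by positivity : (0 : ℝ) < (j : ℝ) + 1)]
    exact (div_le_self (abs_nonneg _) (by linarith [(Nat.cast_nonneg j : (0 : ℝ) ≤ j)])).trans (ha j)
  refine ((summable_mul_pow h hx).mul_right x |>.congr fun j => ?_).hasSum
  ring

/-! ### Constancy and limits on the unit interval -/

/-- Two functions on `(0, 1)` agree if they have the same derivative there and their difference
tends to `0` at the left end point. -/
theorem eqOn_of_hasDerivAt_of_tendsto {f g f' : ℝ → ℝ}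
    (hf : ∀ x ∈ Set.Ioo (0 : ℝ) 1, HasDerivAt f (f' x) x)
    (hg : ∀ x ∈ Set.Ioo (0 : ℝ) 1, HasDerivAt g (f' x) x)
    (hlim : Tendsto (fun x => f x - g x) (𝓝[>] 0) (𝓝 0)) :
    Set.EqOn f g (Set.Ioo 0 1) := by
  intro x hx
  have hd : ∀ y ∈ Set.Ioo (0 : ℝ) 1, HasDerivAt (fun z => f z - g z) 0 y := fun y hy => by
    simpa using! (hf y hy).sub (hg y hy)
  have hc : ∀ y ∈ Set.Ioo (0 : ℝ) 1, f y - g y = f x - g x := fun y hy =>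
    isOpen_Ioo.is_const_of_deriv_eq_zero isPreconnected_Ioo
      (fun z hz => (hd z hz).differentiableAt.differentiableWithinAt)
      (fun z hz => (hd z hz).deriv) hy hx
  have h1 : Tendsto (fun y => f y - g y) (𝓝[>] 0) (𝓝 (f x - g x)) :=
    tendsto_const_nhds.congr' <| by
      filter_upwards [Ioo_mem_nhdsGT one_pos] with y hy using (hc y hy).symm
  exact sub_eq_zero.mp (tendsto_nhds_unique h1 hlim)

/-- A zero of `f` at `0` beats every power of the logarithm, `f` being `O(x)` there. -/
theorem tendsto_mul_log_pow_nhdsGT_zero {f : ℝ → ℝ} (hf : DifferentiableAt ℝ f 0) (h0 : f 0 = 0)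
    (k : ℕ) : Tendsto (fun x => f x * Real.log x ^ k) (𝓝[>] 0) (𝓝 0) := by
  have h1 : f =O[𝓝[>] 0] fun x : ℝ => x := by
    simpa [h0] using hf.hasDerivAt.isBigO_sub.mono nhdsWithin_le_nhds
  have h2 : Tendsto (fun x : ℝ => x * Real.log x ^ k) (𝓝[>] 0) (𝓝 0) := by
    rcases Nat.eq_zero_or_pos k with rfl | hk
    · simpa using! (tendsto_id.mono_left nhdsWithin_le_nhds : Tendsto (fun x : ℝ => x) (𝓝[>] 0) (𝓝 0))
    -- `x log^k x` is the `k`-th power of `x^(1/k) log x`.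
    have hk' : (k : ℝ) ≠ 0 := by positivity
    have h := (tendsto_log_mul_rpow_nhdsGT_zero (r := 1 / k) (by positivity)).pow k
    rw [zero_pow hk.ne'] at h
    refine h.congr' ?_
    filter_upwards [self_mem_nhdsWithin] with x hx
    rw [mul_pow, ← Real.rpow_natCast (x ^ (1 / (k : ℝ))), ← Real.rpow_mul (le_of_lt hx),
      one_div_mul_cancel hk', Real.rpow_one, mul_comm]
  exact (h1.mul (Asymptotics.isBigO_refl _ _)).trans_tendsto h2

/-! ### Polylogarithms -/

theorem polylog_zero_right (s : ℕ) : polylog s 0 = 0 := by simp [polylog]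

theorem polylog_one_right {s : ℕ} (hs : 1 < s) : polylog s 1 = zetaR s := by
  have hsum : Summable fun n : ℕ => 1 / (n : ℝ) ^ s := Real.summable_one_div_nat_pow.mpr hs
  have h : riemannZeta (s : ℂ) = ((∑' n : ℕ, 1 / (n : ℝ) ^ s : ℝ) : ℂ) := by
    rw [zeta_nat_eq_tsum_of_gt_one hs]
    push_cast
    rfl
  rw [zetaR, h, Complex.ofReal_re, hsum.tsum_eq_zero_add, polylog]
  simp
  omega

theorem polylog_one_left {x : ℝ} (hx : |x| < 1) : polylog 1 x = -Real.log (1 - x) := by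
  simpa [polylog] using (Real.hasSum_pow_div_log_of_abs_lt_one hx).tsum_eq

theorem continuousOn_polylog {s : ℕ} (hs : 1 < s) : ContinuousOn (polylog s) (Set.Icc (-1) 1) := by
  have hsum : Summable fun j : ℕ => 1 / ((j : ℝ) + 1) ^ s := by
    simpa using (summable_nat_add_iff 1).mpr (Real.summable_one_div_nat_pow.mpr hs)
  refine continuousOn_tsum (fun j => by fun_prop) hsum fun j x hx => ?_
  rw [norm_div, norm_pow, norm_pow, Real.norm_of_nonneg (by positivity : (0 : ℝ) ≤ (j : ℝ) + 1)]
  gcongr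
  exact pow_le_one₀ (norm_nonneg _) (abs_le.mpr hx)

theorem abs_one_div_succ_pow_le (s j : ℕ) : |1 / ((j : ℝ) + 1) ^ s| ≤ (j : ℝ) + 1 := by
  have h : (1 : ℝ) ≤ (j : ℝ) + 1 := by linarith [(Nat.cast_nonneg j : (0 : ℝ) ≤ j)]
  rw [abs_of_nonneg (by positivity)]
  exact (div_le_one_of_le₀ (one_le_pow₀ h) (by positivity)).trans h

theorem hasDerivAt_polylog_succ (s : ℕ) {x : ℝ} (hx : |x| < 1) :
    HasDerivAt (polylog (s + 1)) (∑' j : ℕ, 1 / ((j : ℝ) + 1) ^ s * x ^ j) x := by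
  convert! hasDerivAt_tsum_div_mul_pow (abs_one_div_succ_pow_le s) hx using 1
  funext y
  refine tsum_congr fun j => ?_
  rw [pow_succ ((j : ℝ) + 1)]
  field_simp

theorem tsum_one_div_mul_pow (s : ℕ) {x : ℝ} (hx : x ≠ 0) :
    ∑' j : ℕ, 1 / ((j : ℝ) + 1) ^ s * x ^ j = polylog s x / x := by
  rw [polylog, ← tsum_div_const]
  refine tsum_congr fun j => ?_
  field_simp
  ring

theorem hasDerivAt_polylog_two {x : ℝ} (h0 : 0 < x) (h1 : x < 1) :
    HasDerivAt (polylog 2) (-Real.log (1 - x) / x) x := by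
  have hx : |x| < 1 := by rwa [abs_of_pos h0]
  simpa only [tsum_one_div_mul_pow 1 h0.ne', polylog_one_left hx] using hasDerivAt_polylog_succ 1 hx

theorem hasDerivAt_polylog_three {x : ℝ} (h0 : 0 < x) (h1 : x < 1) :
    HasDerivAt (polylog 3) (polylog 2 x / x) x := by
  have hx : |x| < 1 := by rwa [abs_of_pos h0]
  simpa only [tsum_one_div_mul_pow 2 h0.ne'] using hasDerivAt_polylog_succ 2 hx

theorem differentiableAt_polylog_zero (s : ℕ) : DifferentiableAt ℝ (polylog (s + 1)) 0 :=
  (hasDerivAt_polylog_succ s (by simp)).differentiableAt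

theorem tendsto_polylog_zero {s : ℕ} (hs : 1 < s) : Tendsto (polylog s) (𝓝 0) (𝓝 0) := by
  have h := (continuousOn_polylog hs).continuousAt (Icc_mem_nhds (by norm_num) one_pos)
  simpa [ContinuousAt, polylog_zero_right] using h

theorem tendsto_polylog_one {s : ℕ} (hs : 1 < s) :
    Tendsto (polylog s) (𝓝[<] 1) (𝓝 (zetaR s)) := by
  have h := (continuousOn_polylog hs 1 (by simp)).mono_left
    (nhdsWithin_le_iff.mpr (Icc_mem_nhdsLT (by norm_num : (-1 : ℝ) < 1)))
  rwa [polylog_one_right hs] at h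

theorem tendsto_one_sub_nhdsGT_zero : Tendsto (fun x : ℝ => 1 - x) (𝓝[>] 0) (𝓝[<] 1) := by
  refine tendsto_nhdsWithin_iff.mpr ⟨?_, ?_⟩
  · exact ((continuous_const.sub continuous_id).tendsto' (0 : ℝ) 1 (by simp)).mono_left
      nhdsWithin_le_nhds
  · filter_upwards [self_mem_nhdsWithin] with x hx using sub_lt_self (1 : ℝ) (Set.mem_Ioi.mp hx)

theorem tendsto_one_sub_nhdsLT_one : Tendsto (fun x : ℝ => 1 - x) (𝓝[<] 1) (𝓝[>] 0) := by
  refine tendsto_nhdsWithin_iff.mpr ⟨?_, ?_⟩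
  · exact ((continuous_const.sub continuous_id).tendsto' (1 : ℝ) 0 (by simp)).mono_left
      nhdsWithin_le_nhds
  · filter_upwards [self_mem_nhdsWithin] with x hx using sub_pos.mpr (Set.mem_Iio.mp hx)

theorem hasDerivAt_log_one_sub {x : ℝ} (hx : x < 1) :
    HasDerivAt (fun y => Real.log (1 - y)) (-1 / (1 - x)) x :=
  ((hasDerivAt_id x).const_sub 1).log (sub_pos.mpr hx).ne'

/-- Euler's reflection formula for the dilogarithm. -/
theorem polylog_two_add_polylog_two_one_sub {x : ℝ} (h0 : 0 < x) (h1 : x < 1) :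
    polylog 2 x + polylog 2 (1 - x) + Real.log x * Real.log (1 - x) = zetaR 2 := by
  refine eqOn_of_hasDerivAt_of_tendsto (f' := fun _ => 0)
    (f := fun x => polylog 2 x + polylog 2 (1 - x) + Real.log x * Real.log (1 - x))
    (g := fun _ => zetaR 2) (fun y hy => ?_) (fun y _ => hasDerivAt_const y _) ?_ ⟨h0, h1⟩
  · obtain ⟨hy0, hy1⟩ := hy
    have hy2 : 0 < 1 - y := sub_pos.mpr hy1
    have hr := (hasDerivAt_polylog_two hy2 (by linarith)).comp y ((hasDerivAt_id y).const_sub 1)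
    have h := ((hasDerivAt_polylog_two hy0 hy1).add hr).add
      ((Real.hasDerivAt_log hy0.ne').mul (hasDerivAt_log_one_sub hy1))
    convert! h using 1
    rw [sub_sub_cancel]
    field_simp
    ring
  · have hl := tendsto_mul_log_pow_nhdsGT_zero
      (hasDerivAt_log_one_sub one_pos).differentiableAt (by simp) 1
    have h := ((((tendsto_polylog_zero one_lt_two).mono_left nhdsWithin_le_nhds).add
      ((tendsto_polylog_one one_lt_two).comp tendsto_one_sub_nhdsGT_zero)).add hl).sub_const (zetaR 2)
    simpa [mul_comm] using! h

/-! ### Generating functions of the harmonic numbers -/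

theorem abs_harm_le (j : ℕ) : |harm j| ≤ (j : ℝ) + 1 := by
  rw [abs_of_nonneg (harm_nonneg j)]
  linarith [harm_le j]

/-- Multiplying the series by `1 - x` turns `H_{j+1} - H_j` into the logarithmic series. -/
theorem hasSum_harm_mul_pow {x : ℝ} (hx : |x| < 1) :
    HasSum (fun j => harm j * x ^ j) (-Real.log (1 - x) / (1 - x)) := by
  obtain ⟨S, hS⟩ := summable_mul_pow abs_harm_le hx
  have h1 := (hasSum_nat_add_iff' 1).mpr hS
  have h2 := h1.sub (hS.mul_right x)
  have h3 : HasSum (fun j : ℕ => x ^ (j + 1) / ((j : ℝ) + 1)) (S - S * x) := by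
    convert! h2 using 1
    · funext j
      rw [harm_succ]
      ring
    · simp [harm_zero]
  have h4 := h3.unique (Real.hasSum_pow_div_log_of_abs_lt_one hx)
  have hx1 : 1 - x ≠ 0 := (sub_pos.mpr ((le_abs_self x).trans_lt hx)).ne'
  convert! hS using 1
  rw [div_eq_iff hx1, ← h4]
  ring

theorem abs_harm_div_le (j : ℕ) : |harm j / ((j : ℝ) + 1)| ≤ (j : ℝ) + 1 := by
  have h : (1 : ℝ) ≤ (j : ℝ) + 1 := by linarith [(Nat.cast_nonneg j : (0 : ℝ) ≤ j)]
  rw [abs_of_nonneg (div_nonneg (harm_nonneg j) (by positivity))]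
  exact (div_le_one_of_le₀ (by linarith [harm_le j]) (by positivity)).trans h

theorem tendsto_tsum_div_mul_pow_zero {a : ℕ → ℝ} (ha : ∀ j : ℕ, |a j| ≤ (j : ℝ) + 1) :
    Tendsto (fun y : ℝ => ∑' j : ℕ, a j / ((j : ℝ) + 1) * y ^ (j + 1)) (𝓝[>] 0) (𝓝 0) := by
  have h := (hasDerivAt_tsum_div_mul_pow ha (x := 0) (by simp)).continuousAt.tendsto
  simpa using h.mono_left nhdsWithin_le_nhds

/-- The generating function `∑ H_{k-1} x ^ k / k` is `log² (1 - x) / 2`. -/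
theorem hasSum_harm_div_mul_pow {x : ℝ} (h0 : 0 < x) (h1 : x < 1) :
    HasSum (fun j : ℕ => harm j / ((j : ℝ) + 1) * x ^ (j + 1)) (1 / 2 * Real.log (1 - x) ^ 2) := by
  have hx : ∀ y ∈ Set.Ioo (0 : ℝ) 1, |y| < 1 := fun y hy => by rw [abs_of_pos hy.1]; exact hy.2
  convert! hasSum_div_mul_pow abs_harm_le (hx x ⟨h0, h1⟩) using 1
  refine (eqOn_of_hasDerivAt_of_tendsto (f' := fun y => -Real.log (1 - y) / (1 - y))
    (f := fun y => ∑' j : ℕ, harm j / ((j : ℝ) + 1) * y ^ (j + 1))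
    (g := fun y => 1 / 2 * Real.log (1 - y) ^ 2)
    (fun y hy => ?_) (fun y hy => ?_) ?_ ⟨h0, h1⟩).symm
  · rw [← (hasSum_harm_mul_pow (hx y hy)).tsum_eq]
    exact hasDerivAt_tsum_div_mul_pow abs_harm_le (hx y hy)
  · convert! ((hasDerivAt_log_one_sub hy.2).pow 2).const_mul (1 / 2 : ℝ) using 1
    ring
  · have hl : Tendsto (fun y : ℝ => 1 / 2 * Real.log (1 - y) ^ 2) (𝓝[>] 0) (𝓝 0) := by
      have h := (((hasDerivAt_log_one_sub one_pos).continuousAt.tendsto.pow 2).const_mul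
        (1 / 2 : ℝ)).mono_left (nhdsWithin_le_nhds (a := (0 : ℝ)) (s := Set.Ioi 0))
      simpa using h
    simpa using (tendsto_tsum_div_mul_pow_zero abs_harm_le).sub hl

theorem closedForm_zero (t : ℝ) : closedForm 0 t = zetaR 3 - polylog 3 (1 - t)
    + (zetaR 2 - polylog 2 t) * Real.log (1 - t) - 1 / 2 * Real.log t * Real.log (1 - t) ^ 2 := by
  simp [closedForm]

/-- The case `n = 0`. Both sides have derivative `log² (1 - x) / (2 x)`; on the closed form this
uses the reflection formula for the dilogarithm. -/
theorem hasSum_closedForm_zero {x : ℝ} (h0 : 0 < x) (h1 : x < 1) :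
    HasSum (fun j : ℕ => seriesTerm 0 x (j + 1)) (closedForm 0 x) := by
  have hx : ∀ y ∈ Set.Ioo (0 : ℝ) 1, |y| < 1 := fun y hy => by rw [abs_of_pos hy.1]; exact hy.2
  convert! hasSum_div_mul_pow abs_harm_div_le (hx x ⟨h0, h1⟩) using 1
  · funext j
    rw [seriesTerm_succ, betaNat_zero_left]
    ring
  refine (eqOn_of_hasDerivAt_of_tendsto (f' := fun y => 1 / 2 * Real.log (1 - y) ^ 2 / y)
    (f := fun y => ∑' j : ℕ, harm j / ((j : ℝ) + 1) / ((j : ℝ) + 1) * y ^ (j + 1))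
    (g := closedForm 0) (fun y hy => ?_) (fun y hy => ?_) ?_ ⟨h0, h1⟩).symm
  · rw [← (hasSum_harm_div_mul_pow hy.1 hy.2).tsum_eq, ← tsum_div_const]
    convert! hasDerivAt_tsum_div_mul_pow abs_harm_div_le (hx y hy) using 1
    refine tsum_congr fun j => ?_
    have := hy.1.ne'
    field_simp
    ring
  · rw [funext closedForm_zero]
    obtain ⟨hy0, hy1⟩ := hy
    have hy2 : 0 < 1 - y := sub_pos.mpr hy1
    have hl := hasDerivAt_log_one_sub hy1
    have hr := (hasDerivAt_polylog_three hy2 (by linarith)).comp y ((hasDerivAt_id y).const_sub 1)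
    have h := ((hr.const_sub (zetaR 3)).add
      (((hasDerivAt_polylog_two hy0 hy1).const_sub (zetaR 2)).mul hl)).sub
      (((Real.hasDerivAt_log hy0.ne').const_mul (1 / 2)).mul (hl.pow 2))
    convert! h using 1
    rw [← polylog_two_add_polylog_two_one_sub hy0 hy1]
    simp only [Pi.pow_apply]
    field_simp
    ring
  · rw [funext closedForm_zero]
    have hd := (hasDerivAt_log_one_sub one_pos)
    have hl := (hd.continuousAt.tendsto).mono_left (nhdsWithin_le_nhds (a := (0 : ℝ)) (s := Set.Ioi 0))
    have hl2 := tendsto_mul_log_pow_nhdsGT_zero (hd.differentiableAt.pow 2) (by simp) 1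
    have h3 := (tendsto_polylog_one (s := 3) (by norm_num)).comp tendsto_one_sub_nhdsGT_zero
    have h2 := (tendsto_polylog_zero one_lt_two).mono_left
      (nhdsWithin_le_nhds (a := (0 : ℝ)) (s := Set.Ioi 0))
    have h := (tendsto_tsum_div_mul_pow_zero abs_harm_div_le).sub
      (((h3.const_sub (zetaR 3)).add ((h2.const_sub (zetaR 2)).mul hl)).sub
      (hl2.const_mul (1 / 2)))
    simp only [sub_zero, Real.log_one, mul_zero, sub_self, add_zero] at h
    refine h.congr fun y => ?_
    simp only [Function.comp_apply, Pi.pow_apply, pow_one]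
    ring

/-! ### The end point `t = 1` -/

theorem tendsto_closedForm_one (n : ℕ) :
    Tendsto (closedForm n) (𝓝[<] 1) (𝓝 (closedForm n 1)) := by
  -- With `s = 1 - t`, the ratio `(t - 1) / t` is `-s / (1 - s)`, which vanishes at `s = 0`.
  have hu : DifferentiableAt ℝ (fun s : ℝ => -s / (1 - s)) 0 := by
    refine DifferentiableAt.div (by fun_prop) (by fun_prop) (by norm_num)
  have hut : Tendsto (fun t : ℝ => (t - 1) / t) (𝓝[<] 1) (𝓝 0) := by
    have : ContinuousAt (fun t : ℝ => (t - 1) / t) 1 :=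
      ContinuousAt.div (by fun_prop) (by fun_prop) one_ne_zero
    simpa using! this.tendsto.mono_left (nhdsWithin_le_nhds (s := Set.Iio 1))
  have hpow : ∀ k i : ℕ, 1 ≤ k →
      Tendsto (fun t : ℝ => ((t - 1) / t) ^ k * Real.log (1 - t) ^ i) (𝓝[<] 1) (𝓝 0) :=
    fun k i hk => by
      have h := (tendsto_mul_log_pow_nhdsGT_zero (hu.pow k) (by simp; omega) i).comp
        tendsto_one_sub_nhdsLT_one
      refine h.congr fun t => ?_
      simp
  have hsum : ∀ (c : ℕ → ℝ) (i : ℕ), Tendsto (fun t : ℝ => Real.log (1 - t) ^ i *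
      ∑ k ∈ Finset.Icc 1 n, c k * ((t - 1) / t) ^ k) (𝓝[<] 1) (𝓝 0) := fun c i => by
    have h := tendsto_finsetSum (Finset.Icc 1 n) fun k hk =>
      (hpow k i (Finset.mem_Icc.mp hk).1).const_mul (c k)
    simp only [mul_zero, Finset.sum_const_zero] at h
    refine h.congr fun t => ?_
    rw [Finset.mul_sum]
    exact Finset.sum_congr rfl fun k _ => by ring
  have hP3 : Tendsto (fun t : ℝ => polylog 3 (1 - t)) (𝓝[<] 1) (𝓝 0) :=
    (tendsto_polylog_zero (by norm_num)).comp
      (tendsto_one_sub_nhdsLT_one.mono_right nhdsWithin_le_nhds)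
  have hLL : Tendsto (fun t : ℝ => Real.log t * Real.log (1 - t) ^ 2) (𝓝[<] 1) (𝓝 0) := by
    have h := (tendsto_mul_log_pow_nhdsGT_zero
      (hasDerivAt_log_one_sub one_pos).differentiableAt (by simp) 2).comp
        tendsto_one_sub_nhdsLT_one
    simpa [Function.comp_def] using h
  -- By reflection, `ζ(2) - Li₂(t) = Li₂(1 - t) + log t log (1 - t)`.
  have hP2 : Tendsto (fun t : ℝ => (zetaR 2 - polylog 2 t) * Real.log (1 - t)) (𝓝[<] 1) (𝓝 0) := by
    have h := ((tendsto_mul_log_pow_nhdsGT_zero (differentiableAt_polylog_zero 1)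
      (polylog_zero_right 2) 1).comp tendsto_one_sub_nhdsLT_one).add hLL
    rw [add_zero] at h
    refine h.congr' ?_
    filter_upwards [Ioo_mem_nhdsLT (one_pos : (0 : ℝ) < 1)] with t ht
    rw [← polylog_two_add_polylog_two_one_sub ht.1 ht.2]
    simp
    ring
  have hfin := tendsto_finsetSum (Finset.range n) fun p _ => (hut.pow p).const_mul
    (∑ k ∈ Finset.Icc 1 (n - p),
      ((harm (p + k) - harm k) / (((p : ℝ) + k) * k) + 1 / ((k : ℝ) ^ 2 * ((p : ℝ) + k))))
  have h := ((((((hP3.const_sub (zetaR 3)).sub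
    ((hsum (fun k => 1 / (k : ℝ)) 2).const_mul (1 / 2))).add hP2).add
    (hsum (fun k => harm k / (k : ℝ)) 1)).sub hfin).sub (hLL.const_mul (1 / 2)))
  have h1 : closedForm n 1 = zetaR 3 - 0 - 1 / 2 * 0 + 0 + 0 - ∑ p ∈ Finset.range n,
      (∑ k ∈ Finset.Icc 1 (n - p),
      ((harm (p + k) - harm k) / (((p : ℝ) + k) * k) + 1 / ((k : ℝ) ^ 2 * ((p : ℝ) + k)))) * 0 ^ p
      - 1 / 2 * 0 := by
    simp [closedForm, polylog_zero_right]
  rw [h1]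
  refine h.congr fun t => ?_
  simp only [closedForm, pow_one]
  ring

/-- Abel's limit theorem for nonnegative coefficients, where summability at the end point comes
for free: the partial sums there are bounded by the limit of the sums. -/
theorem hasSum_of_tendsto_one {a : ℕ → ℝ} (ha : ∀ j, 0 ≤ a j) {f : ℝ → ℝ} {c : ℝ}
    (hf : ∀ t : ℝ, 0 < t → t < 1 → HasSum (fun j => a j * t ^ (j + 1)) (f t))
    (hc : Tendsto f (𝓝[<] 1) (𝓝 c)) : HasSum a c := by
  have hI : ∀ᶠ t : ℝ in 𝓝[<] 1, t ∈ Set.Ioo (0 : ℝ) 1 := Ioo_mem_nhdsLT one_pos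
  have hterm : ∀ j, Tendsto (fun t : ℝ => a j * t ^ (j + 1)) (𝓝[<] 1) (𝓝 (a j)) := fun j => by
    have h : Continuous fun t : ℝ => a j * t ^ (j + 1) := by fun_prop
    exact (h.tendsto' 1 _ (by simp)).mono_left nhdsWithin_le_nhds
  have hs : Summable a := by
    refine summable_of_sum_le ha (c := c) fun u => ?_
    refine le_of_tendsto_of_tendsto (tendsto_finsetSum u fun j _ => hterm j) hc ?_
    filter_upwards [hI] with t ht
    exact sum_le_hasSum u (fun j _ => mul_nonneg (ha j) (pow_nonneg ht.1.le _)) (hf t ht.1 ht.2)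
  have hl : Tendsto f (𝓝[<] 1) (𝓝 (∑' j, a j)) := by
    refine (tendsto_tsum_of_dominated_convergence hs hterm ?_).congr' ?_
    · filter_upwards [hI] with t ht j
      rw [Real.norm_of_nonneg (mul_nonneg (ha j) (pow_nonneg ht.1.le _))]
      exact mul_le_of_le_one_right (ha j) (pow_le_one₀ ht.1.le ht.2.le)
    · filter_upwards [hI] with t ht using (hf t ht.1 ht.2).tsum_eq
  rw [tendsto_nhds_unique hc hl]
  exact hs.hasSum

/-- The series, over `k = j + 1 ≥ 1`, converges to the closed form for every `0 < t ≤ 1`; the value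
of the closed form used at `t = 1` is its limit as `t → 1⁻`. -/
theorem theorem2p11 (n : ℕ) :
    (∀ t : ℝ, 0 < t → t ≤ 1 →
      HasSum (fun j : ℕ => seriesTerm n t (j + 1)) (closedForm n t)) ∧
    Tendsto (closedForm n) (𝓝[<] 1) (𝓝 (closedForm n 1)) := by
  have hlt : ∀ t : ℝ, 0 < t → t < 1 →
      HasSum (fun j : ℕ => seriesTerm n t (j + 1)) (closedForm n t) := fun t h0 h1 =>
    hasSum_closedForm_of_zero h0 h1 (hasSum_harm_div_mul_pow h0 h1) (hasSum_closedForm_zero h0 h1) n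
  refine ⟨fun t h0 h1 => ?_, tendsto_closedForm_one n⟩
  rcases h1.lt_or_eq with h1 | rfl
  · exact hlt t h0 h1
  · simp only [seriesTerm_succ] at hlt ⊢
    simp only [one_pow, mul_one]
    refine hasSum_of_tendsto_one (fun j => ?_) hlt (tendsto_closedForm_one n)
    exact div_nonneg (mul_nonneg (harm_nonneg j) (betaNat_nonneg n j)) (by positivity)
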